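/- Binary source broadcast over a wiretap channel with a shared key. A source emits i.i.d. bits $S_t\sim\mathrm{Bern}(1/2)$. The memoryless channel is $Y_i=X\oplus V_i$ ($i=1,2$, legitimate receivers) and $Z=X\oplus V_0$ (wiretapper), where $(V_0,V_1,V_2)$ is independent of $X$ with $V_i\sim\mathrm{Bern}(p_i)$, $0\le p_0,p_1,p_2\le\frac12$ (and arbitrary dependence among $V_0,V_1,V_2$). A key $K$, uniform on $\{1,\dots,\lfloor 2^{nR_{\mathsf K}}\rfloor\}$ with $R_{\mathsf K}\ge0$ and independent of $S^n$, is shared by the sender and both legitimate receivers. A block code consists of a (possibly stochastic) encoder $(S^n,K)\mapsto X^n$ and (possibly stochastic) decoders $(Y_i^n,K)\mapsto\widehat S_i^n$. Let $d(a^n,b^n)=\frac1n\#\{t:a_t\ne b_t\}$. A tuple $(R_{\mathsf K},R_{\mathsf L},D_0,D_1,D_2)$ is achievable if there is a sequence of block codes such that for every $\epsilon>0$: 1. $\mathbb P[d(S^n,\widehat S_i^n)\le D_i+\epsilon]\to1$ for $i=1,2$; 2. for every sequence of list decoders assigning to each $z^n$ a nonempty list $\mathcal L_n(z^n)\subseteq\{0,1\}^n$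 with $\limsup_n\frac1n\log_2\max_{z^n}|\mathcal L_n(z^n)|\le R_{\mathsf L}-\epsilon$, one has $\mathbb P[\min_{\check s^n\in\mathcal L_n(Z^n)}d(S^n,\check s^n)\ge D_0-\epsilon]\to1$. Let $\mathcal R$ be the set of achievable tuples, $x\star y=(1-x)y+x(1-y)$, $H_2(p)=-p\log_2p-(1-p)\log_2(1-p)$, and $[x]^+=\max\{0,x\}$. Let $\mathcal R^{(\mathsf i)}$ be the union over $p'\in[0,\frac12]$ of the sets of tuples with $R_{\mathsf K}\ge0$, $D_0\in[0,1]$, $$D_i\ge p'\star p_i\quad(i=1,2),\qquad R_{\mathsf L}\le\min\left\{R_{\mathsf K}+\left[H_2(p'\star p_0)-H_2(D_0)\right]^+,\ \left[1-H_2(D_0)\right]^+\right\},$$ and, in case $D_0>\frac12$, also $R_{\mathsf L}\le0$. Then $\mathcal R^{(\mathsf i)}\subseteq\mathcal R$. -/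

import Mathlib

open Filter Topology
open scoped NNReal ENNReal

noncomputable section

namespace ShannonCipher

/-- The law of a vector with independent coordinates, coordinate `t` having law `p t`. -/
def indepLaw {A : Type} [Fintype A] {n : ℕ} (p : Fin n → PMF A) : PMF (Fin n → A) :=
  PMF.ofFintype (fun a => ∏ t, p t (a t)) (by
    classical
    rw [← Fintype.prod_sum]
    refine Finset.prod_eq_one fun t _ => ?_
    exact (tsum_fintype (fun a => p t a)).symm.trans (p t).tsum_coe)

/-- A discrete memoryless Shannon cipher broadcast system with finite alphabets: a source law, a
wiretap broadcast channel `P_{Y₁ Y₂ Z | X}`, and the per-letter distortion measures of the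
legitimate users (`dB`, reconstruction alphabet `Sh`) and of the wiretapper (`dE`,
reconstruction alphabet `Sc`). -/
structure BroadcastSystem (S Sh Sc X Y₁ Y₂ Z : Type) where
  source : PMF S
  channel : X → PMF (Y₁ × Y₂ × Z)
  dB : S → Sh → ℝ
  dE : S → Sc → ℝ

/-- The average per-letter distortion between two blocks of length `n`. -/
def blockDistortion {A B : Type} (d : A → B → ℝ) {n : ℕ} (a : Fin n → A) (b : Fin n → B) : ℝ :=
  (∑ t, d (a t) (b t)) / n

/-- The number of keys `⌊2 ^ (n R_K)⌋` at blocklength `n` and key rate `R_K ≥ 0`. -/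
def keyCount (RK : ℝ≥0) (n : ℕ) : ℕ := ⌊(2 : ℝ) ^ ((n : ℝ) * (RK : ℝ))⌋₊

instance keyCount_neZero (RK : ℝ≥0) (n : ℕ) : NeZero (keyCount RK n) := by
  have h : (1 : ℝ) ≤ (2 : ℝ) ^ ((n : ℝ) * (RK : ℝ)) :=
    Real.one_le_rpow (by norm_num) (by positivity)
  exact ⟨(Nat.floor_pos.mpr h).ne'⟩

/-- A block code of length `n` with `M` keys: a stochastic encoder and two stochastic decoders,
all of which know the key. -/
structure BlockCode (S Sh X Y₁ Y₂ : Type) (n M : ℕ) where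
  enc : (Fin n → S) → Fin M → PMF (Fin n → X)
  dec₁ : (Fin n → Y₁) → Fin M → PMF (Fin n → Sh)
  dec₂ : (Fin n → Y₂) → Fin M → PMF (Fin n → Sh)

/-- The values that enter the constraints: the source block, the wiretapper's observation and the
two legitimate reconstructions. -/
structure Outcome (S Sh Z : Type) (n : ℕ) where
  src : Fin n → S
  eve : Fin n → Z
  rec₁ : Fin n → Sh
  rec₂ : Fin n → Sh

/-- The joint law of source block, wiretapper's observation and reconstructions under a code:
i.i.d. source, independent uniform key, encoder, memoryless channel, decoders. -/
def codeLaw {S Sh Sc X Y₁ Y₂ Z : Type} [Fintype S] [Fintype Y₁] [Fintype Y₂] [Fintype Z]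
    (sys : BroadcastSystem S Sh Sc X Y₁ Y₂ Z) {n M : ℕ} [NeZero M]
    (c : BlockCode S Sh X Y₁ Y₂ n M) : PMF (Outcome S Sh Z n) :=
  (indepLaw fun _ : Fin n => sys.source).bind fun s =>
  (PMF.uniformOfFintype (Fin M)).bind fun k =>
  (c.enc s k).bind fun x =>
  (indepLaw fun t => sys.channel (x t)).bind fun y =>
  (c.dec₁ (fun t => (y t).1) k).bind fun r₁ =>
  (c.dec₂ (fun t => (y t).2.1) k).bind fun r₂ =>
  PMF.pure ⟨s, fun t => (y t).2.2, r₁, r₂⟩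

/-- The probability of an event under a discrete law. -/
def prob {Ω : Type} (P : PMF Ω) (event : Ω → Prop) : ℝ≥0∞ :=
  P.toOuterMeasure {ω | event ω}

/-- The rate (in bits per letter) of a list decoder `L`, i.e. `(1/n) log₂ |L|`, where `|L|` is the
size of its largest list. -/
def listRate {Z Sc : Type} [Fintype Z] {n : ℕ} (L : (Fin n → Z) → Finset (Fin n → Sc)) : ℝ :=
  Real.logb 2 ((Finset.univ.sup fun z => (L z).card : ℕ) : ℝ) / n

/-- The legitimate distortion constraints for a sequence of codes, at slack `ε`. -/
def DistortionConstraint {S Sh Sc X Y₁ Y₂ Z : Type}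
    [Fintype S] [Fintype Y₁] [Fintype Y₂] [Fintype Z]
    (sys : BroadcastSystem S Sh Sc X Y₁ Y₂ Z) (RK : ℝ≥0)
    (code : ∀ n, BlockCode S Sh X Y₁ Y₂ n (keyCount RK n)) (D₁ D₂ ε : ℝ) : Prop :=
  Tendsto (fun n => prob (codeLaw sys (code n)) fun o =>
    blockDistortion sys.dB o.src o.rec₁ ≤ D₁ + ε) atTop (𝓝 1) ∧
  Tendsto (fun n => prob (codeLaw sys (code n)) fun o =>
    blockDistortion sys.dB o.src o.rec₂ ≤ D₂ + ε) atTop (𝓝 1)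

/-- The list secrecy constraint for a sequence of codes, at slack `ε`: against every sequence of
list decoders whose rate is asymptotically at most `R_L - ε`, all entries of the wiretapper's list
(equivalently the best entry) have distortion at least `D₀ - ε` with probability tending to 1. -/
def SecrecyConstraint {S Sh Sc X Y₁ Y₂ Z : Type}
    [Fintype S] [Fintype Y₁] [Fintype Y₂] [Fintype Z]
    (sys : BroadcastSystem S Sh Sc X Y₁ Y₂ Z) (RK : ℝ≥0)
    (code : ∀ n, BlockCode S Sh X Y₁ Y₂ n (keyCount RK n)) (RL D₀ ε : ℝ) : Prop :=
  ∀ L : ∀ n, (Fin n → Z) → Finset (Fin n → Sc),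
    (∀ n z, (L n z).Nonempty) →
    limsup (fun n => ((listRate (L n) : ℝ) : EReal)) atTop ≤ ((RL - ε : ℝ) : EReal) →
    Tendsto (fun n => prob (codeLaw sys (code n)) fun o =>
      ∀ r ∈ L n o.eve, D₀ - ε ≤ blockDistortion sys.dE o.src r) atTop (𝓝 1)

/-- A rate-distortion tuple `(R_K, R_L, D₀, D₁, D₂)`. -/
@[ext]
structure RDTuple where
  RK : ℝ≥0
  RL : ℝ
  D₀ : ℝ
  D₁ : ℝ
  D₂ : ℝ

/-- Achievability: one sequence of codes meets both constraints for every `ε > 0`. -/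
def Achievable {S Sh Sc X Y₁ Y₂ Z : Type}
    [Fintype S] [Fintype Y₁] [Fintype Y₂] [Fintype Z]
    (sys : BroadcastSystem S Sh Sc X Y₁ Y₂ Z) (τ : RDTuple) : Prop :=
  ∃ code : ∀ n, BlockCode S Sh X Y₁ Y₂ n (keyCount τ.RK n), ∀ ε : ℝ, 0 < ε →
    DistortionConstraint sys τ.RK code τ.D₁ τ.D₂ ε ∧
    SecrecyConstraint sys τ.RK code τ.RL τ.D₀ ε

/-- The admissible region: the set of all achievable tuples. -/
def admissibleRegion {S Sh Sc X Y₁ Y₂ Z : Type}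
    [Fintype S] [Fintype Y₁] [Fintype Y₂] [Fintype Z]
    (sys : BroadcastSystem S Sh Sc X Y₁ Y₂ Z) : Set RDTuple :=
  {τ | Achievable sys τ}

/-- The Hamming distortion on bits. -/
def hamming (a b : Bool) : ℝ := if a = b then 0 else 1

/-- The binary system: a `Bern(1/2)` source, Hamming distortions, and the channel
`Y₁ = X ⊕ V₁`, `Y₂ = X ⊕ V₂`, `Z = X ⊕ V₀`, where `(V₁, V₂, V₀)` has law `noise`. -/
def binarySystem (noise : PMF (Bool × Bool × Bool)) :
    BroadcastSystem Bool Bool Bool Bool Bool Bool Bool where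
  source := PMF.uniformOfFintype Bool
  channel x := noise.map fun v => (xor x v.1, xor x v.2.1, xor x v.2.2)
  dB := hamming
  dE := hamming

/-- A law on bits is `Bern(p)`. -/
def IsBern (P : PMF Bool) (p : ℝ) : Prop := P true = ENNReal.ofReal p

/-- Binary convolution. -/
def binConv (x y : ℝ) : ℝ := (1 - x) * y + x * (1 - y)

/-- The binary entropy function, in bits. -/
def H₂ (p : ℝ) : ℝ := -p * Real.logb 2 p - (1 - p) * Real.logb 2 (1 - p)

/-- The inner region for the binary system. The wiretapper's distortion level lies in `[0, 1]`, and
above `1/2` (where the rate-distortion function of the source vanishes) the list rate is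
required to be nonpositive. -/
def binaryInnerRegion (p₀ p₁ p₂ : ℝ) : Set RDTuple :=
  ⋃ p' ∈ Set.Icc (0 : ℝ) (1 / 2),
    {τ | binConv p' p₁ ≤ τ.D₁ ∧ binConv p' p₂ ≤ τ.D₂ ∧
      τ.RL ≤ min ((τ.RK : ℝ) + max 0 (H₂ (binConv p' p₀) - H₂ τ.D₀)) (max 0 (1 - H₂ τ.D₀)) ∧
      τ.D₀ ∈ Set.Icc (0 : ℝ) 1 ∧ (1 / 2 < τ.D₀ → τ.RL ≤ 0)}

end ShannonCipher

end

noncomputable section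

namespace ShannonCipher

/-! ### Bernoulli weights on the Hamming cube -/

/-! The scheme is uncoded. The sender transmits `X = S ⊕ c_K ⊕ U`, where `c_K` is a codeword
selected by the key and `U` is i.i.d. Bern(p'). A receiver adds `c_K` back; its error word `U ⊕ V_i`
is Bern(p' ⋆ p_i), so a Chernoff bound gives the legitimate distortions. Only the marginals of the
channel noise matter.

For secrecy put `q = p' ⋆ p₀` and let `W = U ⊕ V₀`. Since `S` is uniform, `Z = S ⊕ c_K ⊕ W` is
independent of `(K, W)`, and given `Z = z` the source is `z ⊕ c_K ⊕ W`. A list entry `r` therefore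
succeeds when `W` lies within distance `nD` of `l ⊕ c_K`, with `l = z ⊕ r`. After discarding
atypically light `W`, this has probability the average over `k` of `ballMass` at `l ⊕ c_k`, and a
union bound costs the list size (`sum_list_hit_le`).

Two estimates control the average. Each ball has mass at most about `exp(-n [h(q) - h(D)]⁺)`
(`ballMass_le`), and the masses of all `2^n` balls add up to at most `exp(n h(D))`
(`sum_ballMass_le`). An exponential-moment argument on random codebooks (`exists_codebook`) yields
one codebook good for all `2^n` translates `l`: its average is at most the pointwise bound times `n
log 2 / M`, plus twice the global mean. These two terms are the two entries of the minimum bounding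
`R_L`. If `R_L ≤ 0`, no list decoder is admissible and secrecy is vacuous. -/

/-- The Hamming weight of a binary word, as a real number. -/
def weight {n : ℕ} (w : Fin n → Bool) : ℝ := ∑ t, if w t then 1 else 0

/-- The probability of a binary word under independent `Bern(q)` coordinates. -/
def bernWeight (q : ℝ) {n : ℕ} (w : Fin n → Bool) : ℝ := ∏ t, if w t then q else 1 - q

/-- The coordinatewise sum modulo two. -/
def wordXor {n : ℕ} (a b : Fin n → Bool) : Fin n → Bool := fun t => xor (a t) (b t)

theorem wordXor_comm {n : ℕ} (a b : Fin n → Bool) : wordXor a b = wordXor b a := by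
  funext t; simp [wordXor, Bool.xor_comm]

theorem wordXor_assoc {n : ℕ} (a b c : Fin n → Bool) :
    wordXor (wordXor a b) c = wordXor a (wordXor b c) := by
  funext t; simp [wordXor]

theorem wordXor_cancel_left {n : ℕ} (a b : Fin n → Bool) : wordXor a (wordXor a b) = b := by
  funext t; simp [wordXor]

/-- Translation by a word is a permutation of the Hamming cube. -/
def wordXorEquiv {n : ℕ} (a : Fin n → Bool) : (Fin n → Bool) ≃ (Fin n → Bool) where
  toFun := wordXor a
  invFun := wordXor a
  left_inv := wordXor_cancel_left a
  right_inv := wordXor_cancel_left a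

theorem bernWeight_nonneg {q : ℝ} (h0 : 0 ≤ q) (h1 : q ≤ 1) {n : ℕ} (w : Fin n → Bool) :
    0 ≤ bernWeight q w := by
  refine Finset.prod_nonneg fun t _ => ?_
  split_ifs <;> linarith

theorem sum_bernWeight_mul_exp (q lam : ℝ) (n : ℕ) :
    ∑ w : Fin n → Bool, bernWeight q w * Real.exp (lam * weight w) =
      (q * Real.exp lam + (1 - q)) ^ n := by
  have h : ∀ w : Fin n → Bool, bernWeight q w * Real.exp (lam * weight w) =
      ∏ t, (fun b : Bool => if b then q * Real.exp lam else 1 - q) (w t) := by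
    intro w
    rw [bernWeight, weight, Finset.mul_sum, Real.exp_sum, ← Finset.prod_mul_distrib]
    refine Finset.prod_congr rfl fun t _ => ?_
    cases w t <;> simp
  simp_rw [h]
  rw [← Fintype.prod_sum (fun (_ : Fin n) (b : Bool) => if b then q * Real.exp lam else 1 - q)]
  simp

theorem sum_bernWeight (q : ℝ) (n : ℕ) : ∑ w : Fin n → Bool, bernWeight q w = 1 := by
  have h := sum_bernWeight_mul_exp q 0 n
  simpa using h

theorem exp_le_one_add_add_sq {x : ℝ} (hx : |x| ≤ 1) : Real.exp x ≤ 1 + x + x ^ 2 := by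
  have := (abs_le.mp (Real.abs_exp_sub_one_sub_id_le hx)).2
  linarith

/-- A Chernoff bound for the weight of a `Bern(q)` word, for either tail according to the sign
of `lam`. -/
theorem sum_bernWeight_tail_le {q : ℝ} (h0 : 0 ≤ q) (h1 : q ≤ 1) {lam : ℝ} (hl : |lam| ≤ 1)
    (n : ℕ) :
    ∑ w : Fin n → Bool,
      (if 2 * n * lam ^ 2 ≤ lam * (weight w - n * q) then bernWeight q w else 0) ≤
      Real.exp (-(n * lam ^ 2)) := by
  -- The centred moment generating function is at most `exp(n lam²)`; the factor 2 in the threshold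
  -- leaves `exp(-n lam²)`.
  have hbase : q * Real.exp lam + (1 - q) ≤ Real.exp (lam * q + lam ^ 2) := by
    have he := exp_le_one_add_add_sq hl
    have h2 := Real.add_one_le_exp (lam * q + lam ^ 2)
    nlinarith [mul_le_mul_of_nonneg_left he h0, sq_nonneg lam,
      mul_le_mul_of_nonneg_right h1 (sq_nonneg lam)]
  have hpow : (q * Real.exp lam + (1 - q)) ^ n ≤ Real.exp (n * (lam * q + lam ^ 2)) := by
    rw [Real.exp_nat_mul]
    exact pow_le_pow_left₀ (by have := Real.exp_pos lam; nlinarith) hbase n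
  calc _ ≤ ∑ w : Fin n → Bool, (bernWeight q w * Real.exp (lam * weight w)) *
        Real.exp (-(lam * (n * q) + 2 * n * lam ^ 2)) := by
        refine Finset.sum_le_sum fun w _ => ?_
        have hb := bernWeight_nonneg h0 h1 w
        split_ifs with h
        · rw [mul_assoc, ← Real.exp_add]
          exact le_mul_of_one_le_right hb (Real.one_le_exp (by nlinarith))
        · positivity
    _ ≤ Real.exp (n * (lam * q + lam ^ 2)) * Real.exp (-(lam * (n * q) + 2 * n * lam ^ 2)) := by
        rw [← Finset.sum_mul, sum_bernWeight_mul_exp]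
        exact mul_le_mul_of_nonneg_right hpow (Real.exp_pos _).le
    _ = _ := by rw [← Real.exp_add]; congr 1; ring

/-- Expanding around the mean weight `nq` isolates the entropy. For `q ≤ 1/2` the slope `log q - log
(1 - q)` is nonpositive, so one-sided weight bounds become probability bounds. -/
theorem bernWeight_eq_exp {q : ℝ} (h0 : 0 < q) (h1 : q < 1) {n : ℕ} (w : Fin n → Bool) :
    bernWeight q w = Real.exp (-(n * Real.binEntropy q) +
      (weight w - n * q) * (Real.log q - Real.log (1 - q))) := by
  have h : bernWeight q w = Real.exp (weight w * Real.log q + (n - weight w) * Real.log (1 - q)) := by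
    have hn : (n : ℝ) - weight w = ∑ t, if w t then (0 : ℝ) else 1 := by
      have : (n : ℝ) = ∑ t : Fin n, (1 : ℝ) := by simp
      rw [this, weight, ← Finset.sum_sub_distrib]
      exact Finset.sum_congr rfl fun t _ => by split_ifs <;> simp
    rw [hn, weight, Finset.sum_mul, Finset.sum_mul, ← Finset.sum_add_distrib, Real.exp_sum,
      bernWeight]
    refine Finset.prod_congr rfl fun t _ => ?_
    split_ifs
    · simp [Real.exp_log h0]
    · simp [Real.exp_log (sub_pos.mpr h1)]
  rw [h, Real.binEntropy_eq_negMulLog_add_negMulLog_one_sub, Real.negMulLog, Real.negMulLog]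
  congr 1; ring

theorem weight_nonneg {n : ℕ} (w : Fin n → Bool) : 0 ≤ weight w :=
  Finset.sum_nonneg fun t _ => by split_ifs <;> norm_num

theorem log_le_log_one_sub {q : ℝ} (h0 : 0 ≤ q) (h1 : q ≤ 1 / 2) :
    Real.log q ≤ Real.log (1 - q) := by
  rcases h0.eq_or_lt with rfl | h0
  · simp
  · exact Real.log_le_log h0 (by linarith)

/-- The volume of a Hamming ball. -/
theorem card_ball_le {D : ℝ} (h0 : 0 ≤ D) (h1 : D ≤ 1 / 2) (n : ℕ) :
    ∑ w : Fin n → Bool, (if weight w ≤ n * D then (1 : ℝ) else 0) ≤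
      Real.exp (n * Real.binEntropy D) := by
  -- At `D = 0` the exponential form is unavailable, but the ball is a single word. Otherwise each
  -- word of the ball has Bern(D) probability at least `exp(-n h(D))`.
  rcases h0.eq_or_lt with rfl | hD
  · have h : ∀ w : Fin n → Bool, weight w ≤ n * (0 : ℝ) → w = fun _ => false := by
      intro w hw
      have h0 : weight w = 0 := le_antisymm (by simpa using hw) (weight_nonneg w)
      rw [weight, Finset.sum_eq_zero_iff_of_nonneg (fun t _ => by split_ifs <;> norm_num)] at h0
      funext t
      simpa using h0 t (Finset.mem_univ t)
    calc _ ≤ ∑ w : Fin n → Bool, (if w = fun _ => false then (1 : ℝ) else 0) := by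
          refine Finset.sum_le_sum fun w _ => ?_
          by_cases hw : weight w ≤ n * (0 : ℝ)
          · rw [if_pos hw, if_pos (h w hw)]
          · rw [if_neg hw]; split_ifs <;> norm_num
      _ ≤ _ := by simp
  · have hlog := log_le_log_one_sub h0 h1
    have key : ∀ w : Fin n → Bool, (if weight w ≤ n * D then (1 : ℝ) else 0) ≤
        bernWeight D w * Real.exp (n * Real.binEntropy D) := by
      intro w
      split_ifs with hw
      · rw [bernWeight_eq_exp hD (by linarith), ← Real.exp_add]
        exact Real.one_le_exp (by nlinarith)
      · have := bernWeight_nonneg h0 (by linarith) w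
        positivity
    calc _ ≤ _ := Finset.sum_le_sum fun w _ => key w
      _ = _ := by rw [← Finset.sum_mul, sum_bernWeight, one_mul]

/-- Words whose weight is not much below average have probability at most about
`exp (-n h(q))`. -/
theorem bernWeight_le_of_le_weight {q : ℝ} (h0 : 0 ≤ q) (h1 : q ≤ 1 / 2) {n : ℕ} {δ : ℝ}
    {w : Fin n → Bool} (hw : n * (q - δ) ≤ weight w) :
    bernWeight q w ≤
      Real.exp (-(n * Real.binEntropy q) + n * δ * (Real.log (1 - q) - Real.log q)) := by
  rcases h0.eq_or_lt with rfl | hq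
  -- Since `Real.log 0 = 0`, the claimed bound is 1 when `q = 0`.
  · simp only [Real.binEntropy_zero, mul_zero, neg_zero, sub_zero, Real.log_one, Real.log_zero,
      zero_add, Real.exp_zero]
    refine Finset.prod_le_one (fun t _ => ?_) (fun t _ => ?_) <;> split_ifs <;> norm_num
  · rw [bernWeight_eq_exp hq (by linarith)]
    have := log_le_log_one_sub h0 h1
    exact Real.exp_le_exp.mpr (by nlinarith)

/-! ### Random codebooks -/

/-- A random codebook spreads every one of finitely many tests: if each `g i` takes values in
`[0, a]` and has total mass at most `F`, some codebook meets all of them at once. -/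
theorem exists_codebook {ι G : Type} [Fintype ι] [Nonempty ι] [Fintype G] [Nonempty G]
    (M : ℕ) (g : ι → G → ℝ) {a F : ℝ} (ha : 0 < a) (hg0 : ∀ i v, 0 ≤ g i v)
    (hga : ∀ i v, g i v ≤ a) (hF : ∀ i, ∑ v, g i v ≤ F) :
    ∃ c : Fin M → G, ∀ i, ∑ k, g i (c k) ≤
      a * Real.log (Fintype.card ι) + 2 * M * F / Fintype.card G := by
  classical
  set N : ℝ := (Fintype.card G : ℝ) with hN
  have hNpos : 0 < N := by rw [hN]; exact_mod_cast Fintype.card_pos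
  have hIpos : (0 : ℝ) < Fintype.card ι := by exact_mod_cast Fintype.card_pos
  -- Dividing by `a` puts the tests in `[0, 1]`, where `exp x ≤ 1 + 2x`; this is the source of the
  -- factor 2.
  have hsingle : ∀ i, ∑ v, Real.exp (g i v / a) ≤ N * Real.exp (2 * F / (a * N)) := by
    intro i
    calc ∑ v, Real.exp (g i v / a) ≤ ∑ v, (1 + 2 * (g i v / a)) := by
          refine Finset.sum_le_sum fun v _ => ?_
          have h0 : 0 ≤ g i v / a := div_nonneg (hg0 i v) ha.le
          have h1 : g i v / a ≤ 1 := (div_le_one ha).mpr (hga i v)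
          have := exp_le_one_add_add_sq (x := g i v / a) (by rw [abs_of_nonneg h0]; exact h1)
          nlinarith
      _ = N + 2 * (∑ v, g i v) / a := by
          rw [Finset.sum_add_distrib, ← Finset.mul_sum, ← Finset.sum_div]
          simp [hN]; ring
      _ ≤ N + 2 * F / a := by gcongr; exact hF i
      _ = N * (2 * F / (a * N) + 1) := by field_simp; ring
      _ ≤ _ := by gcongr; exact Real.add_one_le_exp _
  set B : ℝ := Fintype.card ι * Real.exp (M * (2 * F / (a * N))) with hB
  -- Summing exponential moments over all tests and averaging over codebooks, with independent
  -- codewords, leaves only a logarithmic price for the number of tests.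
  have htotal : ∑ c : Fin M → G, ∑ i, Real.exp (∑ k, g i (c k) / a) ≤
      ∑ _c : Fin M → G, B := by
    rw [Finset.sum_comm]
    calc ∑ i, ∑ c : Fin M → G, Real.exp (∑ k, g i (c k) / a)
        = ∑ i, (∑ v, Real.exp (g i v / a)) ^ M := by
          refine Finset.sum_congr rfl fun i _ => ?_
          simp_rw [Real.exp_sum]
          rw [← Fintype.prod_sum (fun (_ : Fin M) v => Real.exp (g i v / a))]
          simp
      _ ≤ ∑ _i : ι, (N * Real.exp (2 * F / (a * N))) ^ M := by
          refine Finset.sum_le_sum fun i _ => pow_le_pow_left₀ ?_ (hsingle i) M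
          exact Finset.sum_nonneg fun v _ => (Real.exp_pos _).le
      _ = _ := by
          simp only [Finset.sum_const, Finset.card_univ, nsmul_eq_mul, Fintype.card_fun,
            Fintype.card_fin, mul_pow, ← Real.exp_nat_mul, hB, Nat.cast_pow]
          ring
  obtain ⟨c, -, hc⟩ := Finset.exists_le_of_sum_le Finset.univ_nonempty htotal
  refine ⟨c, fun i => ?_⟩
  have h1 : Real.exp (∑ k, g i (c k) / a) ≤ B :=
    (Finset.single_le_sum (f := fun i => Real.exp (∑ k, g i (c k) / a))
      (fun j _ => (Real.exp_pos _).le) (Finset.mem_univ i)).trans hc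
  have h2 : ∑ k, g i (c k) / a ≤ Real.log (Fintype.card ι) + M * (2 * F / (a * N)) := by
    have := Real.log_le_log (Real.exp_pos _) h1
    rwa [Real.log_exp, hB, Real.log_mul hIpos.ne' (Real.exp_pos _).ne', Real.log_exp] at this
  rw [← Finset.sum_div, div_le_iff₀ ha] at h2
  refine h2.trans_eq ?_
  field_simp

/-- The probability that a `Bern(q)` word is not atypically light and lies within distance `n D` of
`v`. -/
def ballMass (q δ D : ℝ) {n : ℕ} (v : Fin n → Bool) : ℝ :=
  ∑ w : Fin n → Bool,
    if n * (q - δ) ≤ weight w ∧ weight (wordXor v w) ≤ n * D then bernWeight q w else 0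

theorem ballMass_nonneg {q : ℝ} (h0 : 0 ≤ q) (h1 : q ≤ 1) (δ D : ℝ) {n : ℕ} (v : Fin n → Bool) :
    0 ≤ ballMass q δ D v :=
  Finset.sum_nonneg fun w _ => by
    have := bernWeight_nonneg h0 h1 w
    split_ifs <;> simp [this]

theorem sum_ite_weight_wordXor (n : ℕ) (r : ℝ) (v : Fin n → Bool) :
    ∑ w : Fin n → Bool, (if weight (wordXor v w) ≤ r then (1 : ℝ) else 0) =
      ∑ w : Fin n → Bool, (if weight w ≤ r then (1 : ℝ) else 0) :=
  (wordXorEquiv v).sum_comp (fun w => if weight w ≤ r then (1 : ℝ) else 0)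

/-- Either use total mass 1, or multiply the ball volume by the largest probability of a word that
is not light. The second option is why light words are excluded from `ballMass`. -/
theorem ballMass_le {q D δ : ℝ} (hq0 : 0 ≤ q) (hq1 : q ≤ 1 / 2) (hD0 : 0 ≤ D) (hD1 : D ≤ 1 / 2)
    (hδ : 0 ≤ δ) {n : ℕ} (v : Fin n → Bool) :
    ballMass q δ D v ≤ Real.exp (-(n * max 0 (Real.binEntropy q - Real.binEntropy D)) +
      n * δ * (Real.log (1 - q) - Real.log q)) := by
  have hκ := sub_nonneg.mpr (log_le_log_one_sub hq0 hq1)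
  rcases le_total (Real.binEntropy q - Real.binEntropy D) 0 with h | h
  · rw [max_eq_left h]
    calc ballMass q δ D v ≤ ∑ w : Fin n → Bool, bernWeight q w := by
          refine Finset.sum_le_sum fun w _ => ?_
          have := bernWeight_nonneg hq0 (by linarith) w
          split_ifs <;> simp [this]
      _ = 1 := sum_bernWeight q n
      _ ≤ _ := Real.one_le_exp (by simp only [mul_zero, neg_zero, zero_add]; positivity)
  · rw [max_eq_right h]
    set b := Real.exp (-(n * Real.binEntropy q) + n * δ * (Real.log (1 - q) - Real.log q)) with hb
    calc ballMass q δ D v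
        ≤ ∑ w : Fin n → Bool, (if weight (wordXor v w) ≤ n * D then (1 : ℝ) else 0) * b := by
          refine Finset.sum_le_sum fun w _ => ?_
          by_cases hw : n * (q - δ) ≤ weight w
          · have := bernWeight_le_of_le_weight hq0 hq1 hw
            by_cases hv : weight (wordXor v w) ≤ n * D
            · simpa [hw, hv] using this
            · simp [hv]
          · rw [if_neg (fun h => hw h.1)]
            have := (Real.exp_pos (-(n * Real.binEntropy q) +
              n * δ * (Real.log (1 - q) - Real.log q))).le
            split_ifs <;> simp [b, this]
      _ ≤ Real.exp (n * Real.binEntropy D) * b := by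
          rw [← Finset.sum_mul, sum_ite_weight_wordXor]
          exact mul_le_mul_of_nonneg_right (card_ball_le hD0 hD1 n) (Real.exp_pos _).le
      _ = _ := by rw [hb, ← Real.exp_add]; congr 1; ring

/-- Double counting: each `w` lies in the balls of at most `exp(n h(D))` centres, and the weights of
the `w` sum to 1. -/
theorem sum_ballMass_le {q D : ℝ} (hq0 : 0 ≤ q) (hq1 : q ≤ 1 / 2) (hD0 : 0 ≤ D) (hD1 : D ≤ 1 / 2)
    (δ : ℝ) {n : ℕ} (l : Fin n → Bool) :
    ∑ v, ballMass q δ D (wordXor l v) ≤ Real.exp (n * Real.binEntropy D) := by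
  rw [show ∑ v, ballMass q δ D (wordXor l v) = ∑ v, ballMass q δ D v from
    (wordXorEquiv l).sum_comp (fun v => ballMass q δ D v)]
  unfold ballMass
  rw [Finset.sum_comm]
  calc _ ≤ ∑ w : Fin n → Bool, bernWeight q w *
        ∑ v : Fin n → Bool, (if weight (wordXor w v) ≤ n * D then (1 : ℝ) else 0) := by
        refine Finset.sum_le_sum fun w _ => ?_
        rw [Finset.mul_sum]
        refine Finset.sum_le_sum fun v _ => ?_
        have := bernWeight_nonneg hq0 (by linarith) w
        rw [wordXor_comm v w]
        by_cases h1 : weight (wordXor w v) ≤ n * D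
        · by_cases h2 : n * (q - δ) ≤ weight w <;> simp [h1, h2, this]
        · simp [h1]
    _ ≤ ∑ w : Fin n → Bool, bernWeight q w * Real.exp (n * Real.binEntropy D) := by
        refine Finset.sum_le_sum fun w _ => ?_
        rw [sum_ite_weight_wordXor]
        exact mul_le_mul_of_nonneg_left (card_ball_le hD0 hD1 n)
          (bernWeight_nonneg hq0 (by linarith) w)
    _ = _ := by rw [← Finset.sum_mul, sum_bernWeight, one_mul]

/-- A codebook all of whose translates have small average ball mass. -/
theorem exists_codebook_ballMass {q D δ : ℝ} (hq0 : 0 ≤ q) (hq1 : q ≤ 1 / 2) (hD0 : 0 ≤ D)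
    (hD1 : D ≤ 1 / 2) (hδ : 0 ≤ δ) (n M : ℕ) [NeZero M] :
    ∃ c : Fin M → Fin n → Bool, ∀ l, (∑ k, ballMass q δ D (wordXor l (c k))) / M ≤
      Real.exp (-(n * max 0 (Real.binEntropy q - Real.binEntropy D)) +
        n * δ * (Real.log (1 - q) - Real.log q)) * (n * Real.log 2) / M +
      2 * Real.exp (n * Real.binEntropy D) / 2 ^ n := by
  obtain ⟨c, hc⟩ := exists_codebook M (fun l v : Fin n → Bool => ballMass q δ D (wordXor l v))
    (Real.exp_pos _) (fun l v => ballMass_nonneg hq0 (by linarith) δ D _)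
    (fun l v => ballMass_le hq0 hq1 hD0 hD1 hδ _)
    (fun l => sum_ballMass_le hq0 hq1 hD0 hD1 δ l)
  refine ⟨c, fun l => ?_⟩
  have hM : (0 : ℝ) < M := by exact_mod_cast Nat.pos_of_ne_zero (NeZero.ne M)
  rw [div_le_iff₀ hM]
  refine (hc l).trans_eq ?_
  simp only [Fintype.card_fun, Fintype.card_bool, Fintype.card_fin, Nat.cast_pow, Nat.cast_ofNat,
    Real.log_pow]
  field_simp

/-! ### Laws with independent coordinates -/

theorem indepLaw_apply {A : Type} [Fintype A] {n : ℕ} (p : Fin n → PMF A) (a : Fin n → A) :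
    indepLaw p a = ∏ t, p t (a t) := rfl

theorem indepLaw_bind {A B : Type} [Fintype A] [Fintype B] {n : ℕ} (p : Fin n → PMF A)
    (ch : Fin n → A → PMF B) :
    ((indepLaw p).bind fun a => indepLaw fun t => ch t (a t)) =
      indepLaw fun t => (p t).bind (ch t) := by
  classical
  ext b
  rw [PMF.bind_apply, tsum_fintype, indepLaw_apply]
  simp_rw [indepLaw_apply, PMF.bind_apply, tsum_fintype, ← Finset.prod_mul_distrib]
  rw [← Fintype.prod_sum (fun t a => p t a * ch t a (b t))]

theorem indepLaw_pure {A : Type} [Fintype A] {n : ℕ} (a : Fin n → A) :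
    indepLaw (fun t => PMF.pure (a t)) = PMF.pure a := by
  classical
  ext b
  rw [indepLaw_apply, PMF.pure_apply]
  simp_rw [PMF.pure_apply]
  split_ifs with h
  · subst h; simp
  · obtain ⟨t, ht⟩ := Function.ne_iff.mp h
    exact Finset.prod_eq_zero (Finset.mem_univ t) (if_neg ht)

theorem indepLaw_map {A B : Type} [Fintype A] [Fintype B] {n : ℕ} (p : Fin n → PMF A)
    (g : Fin n → A → B) :
    (indepLaw p).map (fun a t => g t (a t)) = indepLaw fun t => (p t).map (g t) := by
  have h := indepLaw_bind p fun t a => PMF.pure (g t a)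
  simp_rw [indepLaw_pure] at h
  exact h

theorem isBern_apply {P : PMF Bool} {p : ℝ} (h0 : 0 ≤ p) (h1 : p ≤ 1) (h : IsBern P p) (b : Bool) :
    P b = ENNReal.ofReal (if b then p else 1 - p) := by
  cases b
  · have hs : P true + P false = 1 := by
      have := P.tsum_coe
      rwa [tsum_fintype, Fintype.sum_bool] at this
    rw [IsBern] at h
    rw [h] at hs
    have : ENNReal.ofReal p + ENNReal.ofReal (1 - p) = 1 := by
      rw [← ENNReal.ofReal_add h0 (by linarith)]; simp
    simpa using (ENNReal.add_right_inj ENNReal.ofReal_ne_top).mp (hs.trans this.symm)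
  · simpa [IsBern] using h

theorem indepLaw_apply_of_isBern {P : PMF Bool} {p : ℝ} (h0 : 0 ≤ p) (h1 : p ≤ 1)
    (h : IsBern P p) {n : ℕ} (w : Fin n → Bool) :
    indepLaw (fun _ => P) w = ENNReal.ofReal (bernWeight p w) := by
  rw [indepLaw_apply, bernWeight, ENNReal.ofReal_prod_of_nonneg]
  · exact Finset.prod_congr rfl fun t _ => isBern_apply h0 h1 h (w t)
  · intro t _; split_ifs <;> linarith

theorem isBern_bind_xor {P Q : PMF Bool} {a b : ℝ} (ha0 : 0 ≤ a) (ha1 : a ≤ 1) (hb0 : 0 ≤ b)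
    (hb1 : b ≤ 1) (hP : IsBern P a) (hQ : IsBern Q b) :
    IsBern (P.bind fun u => Q.map fun v => xor u v) (binConv a b) := by
  have h : ∀ u, (Q.map fun v => xor u v) true = Q (!u) := by
    intro u
    rw [PMF.map_apply, tsum_fintype, Fintype.sum_bool]
    cases u <;> simp
  rw [IsBern, PMF.bind_apply, tsum_fintype, Fintype.sum_bool]
  simp only [h, isBern_apply ha0 ha1 hP, isBern_apply hb0 hb1 hQ]
  rw [← ENNReal.ofReal_mul (by simpa using ha0), ← ENNReal.ofReal_mul (by simpa using ha1),
    ← ENNReal.ofReal_add]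
  · simp [binConv]; ring_nf
  · simp only [if_true, Bool.not_true, Bool.false_eq_true, if_false]
    exact mul_nonneg ha0 (by linarith)
  · simp only [if_true, Bool.not_false, Bool.false_eq_true, if_false]
    exact mul_nonneg (by linarith) hb0

theorem exists_isBern {p : ℝ} (h0 : 0 ≤ p) (h1 : p ≤ 1) : ∃ P : PMF Bool, IsBern P p := by
  refine ⟨PMF.ofFintype (fun b => ENNReal.ofReal (if b then p else 1 - p)) ?_, ?_⟩
  · rw [Fintype.sum_bool, ← ENNReal.ofReal_add (by simpa using h0) (by simpa using h1)]
    simp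
  · simp [IsBern, PMF.ofFintype_apply]

/-! ### Elementary probabilities -/

theorem prob_map {Ω Ω' : Type} (P : PMF Ω) (f : Ω → Ω') (E : Ω' → Prop) :
    prob (P.map f) E = prob P fun ω => E (f ω) :=
  PMF.toOuterMeasure_map_apply _ _ _

theorem prob_bind {Ω Ω' : Type} [Fintype Ω] (P : PMF Ω) (f : Ω → PMF Ω') (E : Ω' → Prop) :
    prob (P.bind f) E = ∑ a, P a * prob (f a) E := by
  rw [prob, PMF.toOuterMeasure_bind_apply, tsum_fintype]
  rfl

open Classical in
theorem prob_fintype {Ω : Type} [Fintype Ω] (P : PMF Ω) (E : Ω → Prop) :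
    prob P E = ∑ a, if E a then P a else 0 := by
  rw [prob, PMF.toOuterMeasure_apply_fintype]
  simp [Set.indicator]

theorem prob_mono {Ω : Type} (P : PMF Ω) {E F : Ω → Prop} (h : ∀ ω, E ω → F ω) :
    prob P E ≤ prob P F :=
  P.toOuterMeasure.mono h

theorem prob_or_le {Ω : Type} (P : PMF Ω) (E F : Ω → Prop) :
    prob P (fun ω => E ω ∨ F ω) ≤ prob P E + prob P F :=
  MeasureTheory.measure_union_le (μ := P.toOuterMeasure) {ω | E ω} {ω | F ω}

theorem prob_true {Ω : Type} (P : PMF Ω) : prob P (fun _ => True) = 1 := by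
  rw [prob, PMF.toOuterMeasure_apply_eq_one_iff]
  exact fun _ _ => trivial

theorem prob_le_one {Ω : Type} (P : PMF Ω) (E : Ω → Prop) : prob P E ≤ 1 :=
  (prob_mono P fun _ _ => trivial).trans_eq (prob_true P)

theorem one_sub_prob_not_le {Ω : Type} (P : PMF Ω) (E : Ω → Prop) :
    1 - prob P (fun ω => ¬ E ω) ≤ prob P E := by
  rw [tsub_le_iff_right, ← prob_true P]
  exact (prob_mono P fun ω _ => Classical.em (E ω)).trans (prob_or_le P E _)

theorem prob_bind_le {Ω Ω' : Type} [Fintype Ω] (P : PMF Ω) (f : Ω → PMF Ω') (E : Ω' → Prop)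
    {b : ℝ≥0∞} (h : ∀ a, prob (f a) E ≤ b) : prob (P.bind f) E ≤ b := by
  rw [prob_bind]
  calc _ ≤ ∑ a, P a * b := Finset.sum_le_sum fun a _ => by gcongr; exact h a
    _ = b := by
      rw [← Finset.sum_mul, ← tsum_fintype (L := SummationFilter.unconditional _), P.tsum_coe,
        one_mul]

/-- Events whose complements have vanishing probability are asymptotically certain. -/
theorem tendsto_prob_one {Ω : ℕ → Type} (P : ∀ n, PMF (Ω n)) (E : ∀ n, Ω n → Prop) (b : ℕ → ℝ)
    (hb : Tendsto b atTop (𝓝 0))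
    (h : ∀ᶠ n in atTop, prob (P n) (fun ω => ¬ E n ω) ≤ ENNReal.ofReal (b n)) :
    Tendsto (fun n => prob (P n) (E n)) atTop (𝓝 1) := by
  have h0 : Tendsto (fun n => 1 - ENNReal.ofReal (b n)) atTop (𝓝 1) := by
    have := ENNReal.tendsto_ofReal hb
    rw [ENNReal.ofReal_zero] at this
    simpa using ENNReal.Tendsto.sub (tendsto_const_nhds (x := (1 : ℝ≥0∞))) this (by simp)
  refine tendsto_of_tendsto_of_tendsto_of_le_of_le' h0 tendsto_const_nhds ?_
    (Eventually.of_forall fun n => prob_le_one _ _)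
  filter_upwards [h] with n hn
  exact (tsub_le_tsub_left hn 1).trans (one_sub_prob_not_le _ _)

/-! ### The uncoded scheme with a one-time codeword -/

/-- The sender adds to the source a codeword chosen by the key and artificial noise; the receivers
remove the codeword. -/
def maskCode {n M : ℕ} (P : PMF Bool) (c : Fin M → Fin n → Bool) :
    BlockCode Bool Bool Bool Bool Bool n M where
  enc s k := indepLaw fun t => P.map fun u => xor (xor (s t) (c k t)) u
  dec₁ y k := PMF.pure (wordXor (c k) y)
  dec₂ y k := PMF.pure (wordXor (c k) y)

/-- The law of the total noise, artificial and channel noise together. -/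
def totalNoise (P : PMF Bool) (noise : PMF (Bool × Bool × Bool)) : PMF (Bool × Bool × Bool) :=
  P.bind fun u => noise.map fun v => (xor u v.1, xor u v.2.1, xor u v.2.2)

/-- Meant for the coordinate projections, which commute with the common shift by `u`; each marginal
of the total noise then falls under `isBern_bind_xor`. -/
theorem totalNoise_map (P : PMF Bool) (noise : PMF (Bool × Bool × Bool))
    (f : Bool × Bool × Bool → Bool)
    (hf : ∀ u v, f (xor u v.1, xor u v.2.1, xor u v.2.2) = xor u (f v)) :
    (totalNoise P noise).map f = P.bind fun u => (noise.map f).map fun v => xor u v := by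
  rw [totalNoise, PMF.map_bind]
  simp_rw [PMF.map_comp]
  congr 1
  funext u
  congr 1
  funext v
  exact hf u v

/-- Per letter, input and channel noise merge as `s ⊕ c ⊕ (u ⊕ v)`. Once the receivers cancel `c`,
the key survives only in the wiretapper's word. -/
theorem codeLaw_maskCode {n M : ℕ} [NeZero M] (noise : PMF (Bool × Bool × Bool)) (P : PMF Bool)
    (c : Fin M → Fin n → Bool) :
    codeLaw (binarySystem noise) (maskCode P c) =
      (indepLaw fun _ : Fin n => PMF.uniformOfFintype Bool).bind fun s =>
      (PMF.uniformOfFintype (Fin M)).bind fun k =>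
      (indepLaw fun _ : Fin n => totalNoise P noise).map fun w =>
        (⟨s, wordXor (wordXor s (c k)) fun t => (w t).2.2, wordXor s fun t => (w t).1,
          wordXor s fun t => (w t).2.1⟩ : Outcome Bool Bool Bool n) := by
  unfold codeLaw
  refine congrArg _ (funext fun s => congrArg _ (funext fun k => ?_))
  simp only [maskCode, PMF.pure_bind]
  rw [← PMF.bind_bind, indepLaw_bind (fun t => P.map fun u => xor (xor (s t) (c k t)) u)
    (fun _ x => (binarySystem noise).channel x)]
  have h : ∀ t, ((P.map fun u => xor (xor (s t) (c k t)) u).bind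
      fun x => (binarySystem noise).channel x) =
      (totalNoise P noise).map fun w => (xor (xor (s t) (c k t)) w.1,
        xor (xor (s t) (c k t)) w.2.1, xor (xor (s t) (c k t)) w.2.2) := by
    intro t
    rw [PMF.bind_map, totalNoise, PMF.map_bind]
    congr 1
    funext u
    simp only [Function.comp, binarySystem, PMF.map_comp]
    congr 1
    funext v
    simp
  simp_rw [h]
  rw [← indepLaw_map (fun _ => totalNoise P noise) fun t w => (xor (xor (s t) (c k t)) w.1,
        xor (xor (s t) (c k t)) w.2.1, xor (xor (s t) (c k t)) w.2.2), PMF.bind_map]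
  refine congrArg _ (funext fun w => ?_)
  simp only [Function.comp]
  refine congrArg _ ?_
  have hx : ∀ a b d : Bool, xor b (xor (xor a b) d) = xor a d := by decide
  simp only [Outcome.mk.injEq]
  refine ⟨trivial, ?_, ?_, ?_⟩ <;> funext t <;> simp only [wordXor, hx]

theorem blockDistortion_hamming {n : ℕ} (a b : Fin n → Bool) :
    blockDistortion hamming a b = weight (wordXor a b) / n := by
  unfold blockDistortion weight hamming wordXor
  congr 1
  refine Finset.sum_congr rfl fun t _ => ?_
  cases a t <;> cases b t <;> simp

theorem prob_indepLaw_comp {e : PMF (Bool × Bool × Bool)} {f : Bool × Bool × Bool → Bool}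
    {n : ℕ} (E : (Fin n → Bool) → Prop) :
    prob (indepLaw fun _ : Fin n => e) (fun w => E fun t => f (w t)) =
      prob (indepLaw fun _ : Fin n => e.map f) E := by
  rw [← indepLaw_map (fun _ => e) (fun _ => f), prob_map]

open Classical in
theorem prob_indepLaw_isBern {P : PMF Bool} {p : ℝ} (h0 : 0 ≤ p) (h1 : p ≤ 1) (h : IsBern P p)
    {n : ℕ} (E : (Fin n → Bool) → Prop) :
    prob (indepLaw fun _ : Fin n => P) E =
      ENNReal.ofReal (∑ w : Fin n → Bool, if E w then bernWeight p w else 0) := by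
  rw [prob_fintype, ENNReal.ofReal_sum_of_nonneg]
  · refine Finset.sum_congr rfl fun w _ => ?_
    split_ifs
    · exact indepLaw_apply_of_isBern h0 h1 h w
    · simp
  · intro w _
    have := bernWeight_nonneg h0 h1 w
    split_ifs <;> simp [this]

/-- Legitimate distortion: the error word of a receiver is `Bern(q)`. -/
theorem prob_weight_gt_le {P : PMF Bool} {p : ℝ} (h0 : 0 ≤ p) (h1 : p ≤ 1) (h : IsBern P p)
    {ε : ℝ} (hε0 : 0 < ε) (hε1 : ε ≤ 1) (n : ℕ) :
    prob (indepLaw fun _ : Fin n => P) (fun w => ¬ weight w / n ≤ p + ε) ≤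
      ENNReal.ofReal (Real.exp (-(n * (ε / 2) ^ 2))) := by
  classical
  rw [prob_indepLaw_isBern h0 h1 h]
  -- With `lam = ε / 2` the Chernoff threshold is a weight of at least `n (p + ε)`.
  refine ENNReal.ofReal_le_ofReal (le_trans (Finset.sum_le_sum fun w _ => ?_)
    (sum_bernWeight_tail_le h0 h1 (lam := ε / 2) (by rw [abs_of_pos] <;> linarith) n))
  have hb := bernWeight_nonneg h0 h1 w
  by_cases hw : weight w / n ≤ p + ε
  · rw [if_neg (not_not.mpr hw)]; split_ifs <;> simp [hb]
  · rw [if_pos hw, if_pos]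
    rcases Nat.eq_zero_or_pos n with rfl | hn
    · simp at hw; linarith
    · have hn' : (0 : ℝ) < n := by exact_mod_cast hn
      rw [not_le, lt_div_iff₀ hn'] at hw
      nlinarith

theorem tendsto_exp_neg_nat_mul {r : ℝ} (hr : 0 < r) :
    Tendsto (fun n : ℕ => Real.exp (-(n * r))) atTop (𝓝 0) := by
  refine Real.tendsto_exp_neg_atTop_nhds_zero.comp ?_
  exact tendsto_natCast_atTop_atTop.atTop_mul_const hr

theorem distortionConstraint_maskCode {RK : ℝ≥0} {noise : PMF (Bool × Bool × Bool)} {P : PMF Bool}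
    {q₁ q₂ D₁ D₂ : ℝ} (c : ∀ n, Fin (keyCount RK n) → Fin n → Bool)
    (hq₁ : q₁ ∈ Set.Icc (0 : ℝ) 1) (hq₂ : q₂ ∈ Set.Icc (0 : ℝ) 1)
    (h₁ : IsBern ((totalNoise P noise).map fun v => v.1) q₁)
    (h₂ : IsBern ((totalNoise P noise).map fun v => v.2.1) q₂)
    (hD₁ : q₁ ≤ D₁) (hD₂ : q₂ ≤ D₂) {ε : ℝ} (hε : 0 < ε) :
    DistortionConstraint (binarySystem noise) RK (fun n => maskCode P (c n)) D₁ D₂ ε := by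
  -- The Chernoff bound needs a bounded parameter; shrinking `ε` only strengthens the claim.
  have hε' : 0 < min ε 1 := lt_min hε one_pos
  have hlim := tendsto_exp_neg_nat_mul (r := (min ε 1 / 2) ^ 2) (by positivity)
  have key : ∀ {q D : ℝ} {f : Bool × Bool × Bool → Bool}, q ∈ Set.Icc (0 : ℝ) 1 → q ≤ D →
      IsBern ((totalNoise P noise).map f) q → ∀ n (s : Fin n → Bool),
      prob (indepLaw fun _ : Fin n => totalNoise P noise) (fun w =>
        ¬ blockDistortion hamming s (wordXor s fun t => f (w t)) ≤ D + ε) ≤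
        ENNReal.ofReal (Real.exp (-(n * (min ε 1 / 2) ^ 2))) := by
    intro q D f hq hD h n s
    refine le_trans ?_ (prob_weight_gt_le hq.1 hq.2 h hε' (min_le_right _ _) n)
    rw [← prob_indepLaw_comp]
    refine prob_mono _ fun w hw hw' => hw ?_
    rw [blockDistortion_hamming, wordXor_cancel_left]
    have := min_le_left ε 1
    linarith
  constructor
  · refine tendsto_prob_one _ _ _ hlim (Eventually.of_forall fun n => ?_)
    rw [codeLaw_maskCode]
    refine prob_bind_le _ _ _ fun s => prob_bind_le _ _ _ fun k => ?_
    rw [prob_map]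
    exact key (f := fun v => v.1) hq₁ hD₁ h₁ n s
  · refine tendsto_prob_one _ _ _ hlim (Eventually.of_forall fun n => ?_)
    rw [codeLaw_maskCode]
    refine prob_bind_le _ _ _ fun s => prob_bind_le _ _ _ fun k => ?_
    rw [prob_map]
    exact key (f := fun v => v.2.1) hq₂ hD₂ h₂ n s

/-! ### List secrecy -/

theorem sum_bernWeight_light_le {q δ : ℝ} (h0 : 0 ≤ q) (h1 : q ≤ 1) (hδ0 : 0 ≤ δ) (hδ1 : δ ≤ 1)
    (n : ℕ) :
    ∑ w : Fin n → Bool, (if n * (q - δ) ≤ weight w then 0 else bernWeight q w) ≤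
      Real.exp (-(n * (δ / 2) ^ 2)) := by
  have h := sum_bernWeight_tail_le h0 h1 (lam := -(δ / 2))
    (by rw [abs_neg, abs_of_nonneg] <;> linarith) n
  rw [neg_sq] at h
  refine le_trans (Finset.sum_le_sum fun w _ => ?_) h
  have hb := bernWeight_nonneg h0 h1 w
  by_cases hw : n * (q - δ) ≤ weight w
  · rw [if_pos hw]; split_ifs <;> simp [hb]
  · rw [if_neg hw, if_pos]
    rw [not_le] at hw
    nlinarith

open Classical in
/-- The union bound over the wiretapper's list, the wiretapper's observation being independent of
the key and of the noise. -/
theorem sum_list_hit_le {q δ D B : ℝ} (h0 : 0 ≤ q) (h1 : q ≤ 1) (hδ0 : 0 ≤ δ) (hδ1 : δ ≤ 1)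
    {n M : ℕ} (c : Fin M → Fin n → Bool)
    (hc : ∀ l, ∑ k, ballMass q δ D (wordXor l (c k)) ≤ M * B)
    (L : (Fin n → Bool) → Finset (Fin n → Bool)) {N : ℕ} (hL : ∀ z, (L z).card ≤ N)
    (bad : (Fin n → Bool) → (Fin n → Bool) → Prop)
    (hbad : ∀ s z, bad s z → ∃ r ∈ L z, weight (wordXor s r) ≤ n * D) :
    ∑ s, ∑ k, ∑ w, (if bad s (wordXor (wordXor s (c k)) w) then bernWeight q w else 0) ≤
      2 ^ n * (M * (Real.exp (-(n * (δ / 2) ^ 2)) + N * B)) := by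
  -- For fixed `k` and `w`, the map `s ↦ z` is a bijection of the cube: this is the independence of
  -- `Z` from key and noise.
  have hreindex : ∑ s, ∑ k, ∑ w, (if bad s (wordXor (wordXor s (c k)) w) then bernWeight q w else 0)
      = ∑ z, ∑ k, ∑ w, (if bad (wordXor (wordXor (c k) w) z) z then bernWeight q w else 0) := by
    have hswap : ∀ φ : (Fin n → Bool) → Fin M → (Fin n → Bool) → ℝ,
        ∑ s, ∑ k, ∑ w, φ s k w = ∑ k, ∑ w, ∑ s, φ s k w := fun φ =>
      Finset.sum_comm.trans (Finset.sum_congr rfl fun k _ => Finset.sum_comm)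
    refine (hswap _).trans (Eq.trans ?_ (hswap _).symm)
    refine Finset.sum_congr rfl fun k _ => Finset.sum_congr rfl fun w _ => ?_
    refine Fintype.sum_equiv (wordXorEquiv (wordXor (c k) w)) _ _ fun s => ?_
    have e₁ : wordXorEquiv (wordXor (c k) w) s = wordXor (wordXor s (c k)) w := by
      rw [wordXor_assoc, wordXor_comm s]; rfl
    have e₂ : wordXor (wordXor (c k) w) (wordXor (wordXor s (c k)) w) = s := by
      rw [wordXor_assoc s, wordXor_comm s, wordXor_cancel_left]
    rw [e₁, e₂]
  have hB : 0 ≤ (M : ℝ) * B :=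
    (Finset.sum_nonneg fun k _ => ballMass_nonneg h0 h1 δ D _).trans (hc fun _ => false)
  rw [hreindex]
  have hz : ∀ z, ∑ k, ∑ w, (if bad (wordXor (wordXor (c k) w) z) z then bernWeight q w else 0) ≤
      M * (Real.exp (-(n * (δ / 2) ^ 2)) + N * B) := by
    intro z
    -- A bad triple has light noise or hits some list entry `r`; in the second case the codebook
    -- bound applies with translate `z ⊕ r`.
    calc _ ≤ ∑ k, ∑ w, ((if n * (q - δ) ≤ weight w then 0 else bernWeight q w) +
          ∑ r ∈ L z, if n * (q - δ) ≤ weight w ∧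
            weight (wordXor (wordXor (wordXor z r) (c k)) w) ≤ n * D
            then bernWeight q w else 0) := by
          refine Finset.sum_le_sum fun k _ => Finset.sum_le_sum fun w _ => ?_
          have hb := bernWeight_nonneg h0 h1 w
          have hnn : 0 ≤ ∑ r ∈ L z, if n * (q - δ) ≤ weight w ∧
              weight (wordXor (wordXor (wordXor z r) (c k)) w) ≤ n * D
              then bernWeight q w else 0 :=
            Finset.sum_nonneg fun r _ => by split_ifs <;> simp [hb]
          by_cases hw : n * (q - δ) ≤ weight w
          · rw [if_pos hw, zero_add]
            split_ifs with h
            · obtain ⟨r, hr, hd⟩ := hbad _ _ h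
              have he : wordXor (wordXor (wordXor z r) (c k)) w =
                  wordXor (wordXor (wordXor (c k) w) z) r := by
                rw [wordXor_assoc, wordXor_comm, wordXor_assoc (wordXor (c k) w)]
              refine le_trans ?_ (Finset.single_le_sum (fun r _ => ?_) hr)
              · rw [if_pos ⟨hw, he ▸ hd⟩]
              · split_ifs <;> simp [hb]
            · exact hnn
          · rw [if_neg hw]
            split_ifs <;> linarith
      _ = M * ∑ w, (if n * (q - δ) ≤ weight w then 0 else bernWeight q w) +
          ∑ r ∈ L z, ∑ k, ballMass q δ D (wordXor (wordXor z r) (c k)) := by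
          simp_rw [Finset.sum_add_distrib]
          congr 1
          · rw [Finset.sum_const, Finset.card_univ, Fintype.card_fin, nsmul_eq_mul]
          · rw [Finset.sum_comm (s := L z)]
            refine Finset.sum_congr rfl fun k _ => ?_
            rw [Finset.sum_comm]
            rfl
      _ ≤ M * Real.exp (-(n * (δ / 2) ^ 2)) + ∑ _r ∈ L z, (M : ℝ) * B := by
          gcongr
          · exact sum_bernWeight_light_le h0 h1 hδ0 hδ1 n
          · exact hc _
      _ ≤ M * Real.exp (-(n * (δ / 2) ^ 2)) + N * (M * B) := by
          rw [Finset.sum_const, nsmul_eq_mul]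
          gcongr
          exact hL z
      _ = _ := by ring
  calc _ ≤ _ := Finset.sum_le_sum fun z _ => hz z
    _ = _ := by simp

/-- Source and key are uniform, so this is the counting bound `sum_list_hit_le` divided by `2^n M`.
-/
theorem prob_list_hit_le {q δ D B : ℝ} (h0 : 0 ≤ q) (h1 : q ≤ 1) (hδ0 : 0 ≤ δ) (hδ1 : δ ≤ 1)
    {n M : ℕ} [NeZero M] {noise : PMF (Bool × Bool × Bool)} {P : PMF Bool}
    (hq : IsBern ((totalNoise P noise).map fun v => v.2.2) q)
    (c : Fin M → Fin n → Bool)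
    (hc : ∀ l, (∑ k, ballMass q δ D (wordXor l (c k))) / M ≤ B)
    (L : (Fin n → Bool) → Finset (Fin n → Bool))
    (bad : (Fin n → Bool) → (Fin n → Bool) → Prop)
    (hbad : ∀ s z, bad s z → ∃ r ∈ L z, weight (wordXor s r) ≤ n * D) :
    prob (codeLaw (binarySystem noise) (maskCode P c)) (fun o => bad o.src o.eve) ≤
      ENNReal.ofReal (Real.exp (-(n * (δ / 2) ^ 2)) +
        (Finset.univ.sup fun z => (L z).card : ℕ) * B) := by
  classical
  have hM : (0 : ℝ) < M := by exact_mod_cast Nat.pos_of_ne_zero (NeZero.ne M)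
  have hmain := sum_list_hit_le h0 h1 hδ0 hδ1 c
    (fun l => by have := hc l; rwa [div_le_iff₀' hM] at this) L
    (fun z => Finset.le_sup (f := fun z => (L z).card) (Finset.mem_univ z)) bad hbad
  set T : (Fin n → Bool) → Fin M → ℝ := fun s k =>
    ∑ w, (if bad s (wordXor (wordXor s (c k)) w) then bernWeight q w else 0) with hT
  have hT0 : ∀ s k, 0 ≤ T s k := fun s k => Finset.sum_nonneg fun w _ => by
    have := bernWeight_nonneg h0 h1 w
    split_ifs <;> simp [this]
  have hprob : prob (codeLaw (binarySystem noise) (maskCode P c)) (fun o => bad o.src o.eve) =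
      ENNReal.ofReal (((2 : ℝ) ^ n)⁻¹ * ((M : ℝ)⁻¹ * ∑ s, ∑ k, T s k)) := by
    have hk : ∀ s, prob ((PMF.uniformOfFintype (Fin M)).bind fun k =>
        (indepLaw fun _ : Fin n => totalNoise P noise).map fun w =>
        (⟨s, wordXor (wordXor s (c k)) fun t => (w t).2.2, wordXor s fun t => (w t).1,
          wordXor s fun t => (w t).2.1⟩ : Outcome Bool Bool Bool n)) (fun o => bad o.src o.eve) =
        ENNReal.ofReal ((M : ℝ)⁻¹ * ∑ k, T s k) := by
      intro s
      rw [prob_bind, ENNReal.ofReal_mul (by positivity),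
        ENNReal.ofReal_sum_of_nonneg (fun k _ => hT0 s k), Finset.mul_sum]
      refine Finset.sum_congr rfl fun k _ => ?_
      rw [prob_map, prob_indepLaw_comp (f := fun v => v.2.2)
        (fun w => bad s (wordXor (wordXor s (c k)) w)), prob_indepLaw_isBern h0 h1 hq]
      congr 1
      rw [PMF.uniformOfFintype_apply, ENNReal.ofReal_inv_of_pos hM]
      simp
    rw [codeLaw_maskCode, prob_bind]
    simp_rw [hk]
    rw [ENNReal.ofReal_mul (by positivity), Finset.mul_sum, ENNReal.ofReal_sum_of_nonneg
      (fun s _ => mul_nonneg (by positivity) (Finset.sum_nonneg fun k _ => hT0 s k)),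
      Finset.mul_sum]
    refine Finset.sum_congr rfl fun s _ => ?_
    congr 1
    rw [indepLaw_apply, ENNReal.ofReal_inv_of_pos (by positivity), ENNReal.ofReal_pow (by norm_num)]
    simp [PMF.uniformOfFintype_apply, ENNReal.inv_pow]
  rw [hprob]
  refine ENNReal.ofReal_le_ofReal ?_
  rw [← div_eq_inv_mul, ← div_eq_inv_mul, div_div, div_le_iff₀ (by positivity)]
  refine hmain.trans_eq ?_
  ring

/-! ### Rates -/

theorem H₂_mul_log_two (p : ℝ) : H₂ p * Real.log 2 = Real.binEntropy p := by
  have : Real.log 2 ≠ 0 := (Real.log_pos one_lt_two).ne'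
  rw [H₂, Real.binEntropy_eq_negMulLog_add_negMulLog_one_sub, Real.negMulLog, Real.negMulLog,
    Real.logb, Real.logb]
  field_simp
  ring

/-- Because the key count is at least 1, taking the floor costs at most a factor 2. -/
theorem le_two_mul_keyCount (RK : ℝ≥0) (n : ℕ) :
    Real.exp (n * (RK * Real.log 2)) ≤ 2 * keyCount RK n := by
  have h : Real.exp (n * (RK * Real.log 2)) = (2 : ℝ) ^ ((n : ℝ) * (RK : ℝ)) := by
    rw [Real.rpow_def_of_pos two_pos]; congr 1; ring
  rw [h]
  have h1 : (1 : ℝ) ≤ keyCount RK n := by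
    exact_mod_cast Nat.pos_of_ne_zero (NeZero.ne (keyCount RK n))
  have h2 := (Nat.lt_floor_add_one ((2 : ℝ) ^ ((n : ℝ) * (RK : ℝ)))).le
  change _ ≤ (keyCount RK n : ℝ) + 1 at h2
  linarith

theorem one_le_sup_card {n : ℕ} {L : (Fin n → Bool) → Finset (Fin n → Bool)}
    (hL : ∀ z, (L z).Nonempty) :
    1 ≤ (Finset.univ.sup fun z => (L z).card : ℕ) :=
  (Nat.one_le_iff_ne_zero.mpr (Finset.card_pos.mpr (hL fun _ => false)).ne').trans
    (Finset.le_sup (f := fun z => (L z).card) (Finset.mem_univ _))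

theorem listRate_nonneg {n : ℕ} {L : (Fin n → Bool) → Finset (Fin n → Bool)}
    (hL : ∀ z, (L z).Nonempty) : 0 ≤ listRate L :=
  div_nonneg (Real.logb_nonneg one_lt_two (by exact_mod_cast one_le_sup_card hL)) (by positivity)

/-- Nonempty lists have nonnegative rate, so nonpositive rates impose no secrecy constraint. -/
theorem secrecyConstraint_of_nonpos {noise : PMF (Bool × Bool × Bool)} {RK : ℝ≥0}
    (code : ∀ n, BlockCode Bool Bool Bool Bool Bool n (keyCount RK n)) {RL : ℝ} (hRL : RL ≤ 0)
    (D₀ : ℝ) {ε : ℝ} (hε : 0 < ε) : SecrecyConstraint (binarySystem noise) RK code RL D₀ ε := by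
  intro L hL hlim
  exfalso
  have h : (0 : EReal) ≤ limsup (fun n => ((listRate (L n) : ℝ) : EReal)) atTop :=
    le_limsup_of_frequently_le (Frequently.of_forall fun n => by
      exact_mod_cast listRate_nonneg (hL n))
  have h2 := h.trans hlim
  have : (0 : ℝ) ≤ RL - ε := by exact_mod_cast h2
  linarith

theorem eventually_card_le {L : ∀ n, (Fin n → Bool) → Finset (Fin n → Bool)}
    (hL : ∀ n z, (L n z).Nonempty) {R R' : ℝ}
    (hlim : limsup (fun n => ((listRate (L n) : ℝ) : EReal)) atTop ≤ ((R : ℝ) : EReal))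
    (hR : R < R') :
    ∀ᶠ n in atTop, ((Finset.univ.sup fun z => (L n z).card : ℕ) : ℝ) ≤
      Real.exp (n * (R' * Real.log 2)) := by
  have h : limsup (fun n => ((listRate (L n) : ℝ) : EReal)) atTop < ((R' : ℝ) : EReal) :=
    hlim.trans_lt (by exact_mod_cast hR)
  filter_upwards [eventually_lt_of_limsup_lt h, eventually_gt_atTop 0] with n hn hn0
  have hn' : listRate (L n) < R' := by exact_mod_cast hn
  have hpos : (0 : ℝ) < n := by exact_mod_cast hn0
  have hlog : 0 < Real.log 2 := Real.log_pos one_lt_two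
  have hc : (0 : ℝ) < (Finset.univ.sup fun z => (L n z).card : ℕ) := by
    exact_mod_cast one_le_sup_card (hL n)
  rw [listRate, Real.logb, div_div, div_lt_iff₀ (by positivity)] at hn'
  rw [← Real.log_le_iff_le_exp hc]
  linarith

theorem tendsto_nat_mul_exp_neg {r : ℝ} (hr : 0 < r) :
    Tendsto (fun n : ℕ => n * Real.exp (-(n * r))) atTop (𝓝 0) := by
  have h := (Real.tendsto_pow_mul_exp_neg_atTop_nhds_zero 1).comp
    (tendsto_natCast_atTop_atTop (R := ℝ).atTop_mul_const hr)
  have h2 := h.mul_const r⁻¹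
  rw [zero_mul] at h2
  refine h2.congr fun n => ?_
  simp only [Function.comp, pow_one]
  field_simp

/-! ### Vanishing typicality slack and the secrecy exponent -/

/-- The slack of the typicality condition at blocklength `n`. -/
def typSlack (n : ℕ) : ℝ := min 1 ((n : ℝ) ^ (-(1 / 4) : ℝ))

theorem typSlack_nonneg (n : ℕ) : 0 ≤ typSlack n := le_min zero_le_one (by positivity)

theorem typSlack_le_one (n : ℕ) : typSlack n ≤ 1 := min_le_left _ _

theorem tendsto_typSlack : Tendsto typSlack atTop (𝓝 0) := by
  have h : Tendsto (fun n : ℕ => (n : ℝ) ^ (-(1 / 4) : ℝ)) atTop (𝓝 0) :=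
    (tendsto_rpow_neg_atTop (by norm_num)).comp tendsto_natCast_atTop_atTop
  exact squeeze_zero typSlack_nonneg (fun n => min_le_right _ _) h

/-- The exponent 1/4 is below 1/2, so `n δ²` grows like `√n` although `δ → 0`. A slack independent
of `ε` lets one codebook sequence serve every `ε`. -/
theorem tendsto_exp_typSlack :
    Tendsto (fun n : ℕ => Real.exp (-(n * (typSlack n / 2) ^ 2))) atTop (𝓝 0) := by
  refine Real.tendsto_exp_neg_atTop_nhds_zero.comp ?_
  have h : Tendsto (fun n : ℕ => (n : ℝ) ^ (1 / 2 : ℝ) * (1 / 4)) atTop atTop :=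
    ((tendsto_rpow_atTop (by norm_num)).comp tendsto_natCast_atTop_atTop).atTop_mul_const
      (by norm_num)
  refine h.congr' ?_
  filter_upwards [eventually_ge_atTop 1] with n hn
  have hn' : (1 : ℝ) ≤ n := by exact_mod_cast hn
  have hpos : (0 : ℝ) < n := by linarith
  have h2 : (n : ℝ) * ((n : ℝ) ^ (-(1 / 4) : ℝ)) ^ 2 = (n : ℝ) ^ (1 / 2 : ℝ) := by
    rw [← Real.rpow_natCast, ← Real.rpow_mul hpos.le, ← Real.rpow_one_add' hpos.le] <;> norm_num
  rw [typSlack, min_eq_right (Real.rpow_le_one_of_one_le_of_nonpos hn' (by norm_num)), ← h2]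
  ring

/-- The list size leaves a rate gap `ε/2`. In the first codebook term the typicality slack uses
`ε/4` and the other `ε/4` beats the factor `n`; the second term keeps all of `ε/2`. -/
theorem secrecyConstraint_maskCode {RK : ℝ≥0} {noise : PMF (Bool × Bool × Bool)} {P : PMF Bool}
    {q RL D : ℝ} (hq0 : 0 ≤ q) (hq1 : q ≤ 1 / 2)
    (hq : IsBern ((totalNoise P noise).map fun v => v.2.2) q)
    (hRL : RL ≤ min ((RK : ℝ) + max 0 (H₂ q - H₂ D)) (1 - H₂ D))
    (c : ∀ n, Fin (keyCount RK n) → Fin n → Bool)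
    (hc : ∀ n l, (∑ k, ballMass q (typSlack n) D (wordXor l (c n k))) / keyCount RK n ≤
      Real.exp (-(n * max 0 (Real.binEntropy q - Real.binEntropy D)) +
        n * typSlack n * (Real.log (1 - q) - Real.log q)) * (n * Real.log 2) / keyCount RK n +
      2 * Real.exp (n * Real.binEntropy D) / 2 ^ n)
    {ε : ℝ} (hε : 0 < ε) :
    SecrecyConstraint (binarySystem noise) RK (fun n => maskCode P (c n)) RL D ε := by
  intro L hL hlim
  set ℓ := Real.log 2 with hℓ
  have hℓ0 : 0 < ℓ := Real.log_pos one_lt_two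
  set κ := Real.log (1 - q) - Real.log q with hκ
  have hslack : ∀ᶠ n in atTop, typSlack n * κ < ε / 4 * ℓ := by
    have h := tendsto_typSlack.mul_const κ
    rw [zero_mul] at h
    exact h.eventually_lt_const (by positivity)
  have hb : Tendsto (fun n : ℕ => Real.exp (-(n * (typSlack n / 2) ^ 2)) +
      (n * Real.exp (-(n * (ε / 4 * ℓ))) * (2 * ℓ) +
        Real.exp (-(n * (ε / 2 * ℓ))) * 2)) atTop (𝓝 0) := by
    have h := tendsto_exp_typSlack.add
      (((tendsto_nat_mul_exp_neg (r := ε / 4 * ℓ) (by positivity)).mul_const (2 * ℓ)).add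
        ((tendsto_exp_neg_nat_mul (r := ε / 2 * ℓ) (by positivity)).mul_const 2))
    simpa using h
  refine tendsto_prob_one _ _ _ hb ?_
  filter_upwards [hslack, eventually_gt_atTop 0,
    eventually_card_le hL hlim (R' := RL - ε / 2) (by linarith)] with n hδ hn hcard
  have hn' : (0 : ℝ) < n := by exact_mod_cast hn
  refine (prob_list_hit_le hq0 (by linarith) (typSlack_nonneg n) (typSlack_le_one n) hq (c n)
    (hc n) (L n) (fun s z => ¬ ∀ r ∈ L n z, D - ε ≤ blockDistortion hamming s r) ?_).trans
    (ENNReal.ofReal_le_ofReal ?_)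
  · intro s z h
    push Not at h
    obtain ⟨r, hr, hd⟩ := h
    refine ⟨r, hr, ?_⟩
    -- Distortion below `D - ε` is relaxed to at most `D`; `ε` is spent only on the list rate.
    rw [blockDistortion_hamming, div_lt_iff₀ hn'] at hd
    nlinarith
  · gcongr
    set N : ℝ := ((Finset.univ.sup fun z => (L n z).card : ℕ) : ℝ)
    have hM : (0 : ℝ) < keyCount RK n := by
      exact_mod_cast Nat.pos_of_ne_zero (NeZero.ne (keyCount RK n))
    have hMinv : 1 / (keyCount RK n : ℝ) ≤ 2 * Real.exp (-(n * (RK * ℓ))) := by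
      rw [div_le_iff₀ hM, Real.exp_neg, mul_right_comm, ← div_eq_mul_inv,
        le_div_iff₀ (Real.exp_pos _), one_mul]
      exact le_two_mul_keyCount RK n
    have hR1 : RL * ℓ ≤ RK * ℓ + max 0 (Real.binEntropy q - Real.binEntropy D) := by
      have h := mul_le_mul_of_nonneg_right (hRL.trans (min_le_left _ _)) hℓ0.le
      rwa [add_mul, max_mul_of_nonneg _ _ hℓ0.le, sub_mul, H₂_mul_log_two, H₂_mul_log_two,
        zero_mul] at h
    have hR2 : RL * ℓ ≤ ℓ - Real.binEntropy D := by
      have h := mul_le_mul_of_nonneg_right (hRL.trans (min_le_right _ _)) hℓ0.le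
      rwa [sub_mul, H₂_mul_log_two, one_mul] at h
    set m := max 0 (Real.binEntropy q - Real.binEntropy D)
    have h2n : (2 : ℝ) ^ n = Real.exp (n * ℓ) := by
      rw [Real.exp_nat_mul, hℓ, Real.exp_log two_pos]
    calc N * (Real.exp (-(n * m) + n * typSlack n * κ) * (n * ℓ) / keyCount RK n +
          2 * Real.exp (n * Real.binEntropy D) / 2 ^ n)
        = N * Real.exp (-(n * m) + n * typSlack n * κ) * (n * ℓ) * (1 / keyCount RK n) +
          N * (2 * Real.exp (n * Real.binEntropy D) / 2 ^ n) := by ring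
      _ ≤ Real.exp (n * ((RL - ε / 2) * ℓ)) * Real.exp (-(n * m) + n * typSlack n * κ) * (n * ℓ) *
            (2 * Real.exp (-(n * (RK * ℓ)))) +
          Real.exp (n * ((RL - ε / 2) * ℓ)) * (2 * Real.exp (n * Real.binEntropy D) / 2 ^ n) := by
          gcongr
      _ = n * Real.exp (n * ((RL - ε / 2) * ℓ) + (-(n * m) + n * typSlack n * κ) +
            -(n * (RK * ℓ))) * (2 * ℓ) +
          Real.exp (n * ((RL - ε / 2) * ℓ) + n * Real.binEntropy D - n * ℓ) * 2 := by
          rw [h2n, Real.exp_add _ (-(n * (RK * ℓ))), Real.exp_add (n * ((RL - ε / 2) * ℓ)),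
            Real.exp_sub, Real.exp_add (n * ((RL - ε / 2) * ℓ))]
          ring
      _ ≤ _ := by
          gcongr
          · nlinarith
          · nlinarith

/-! ### Assembling the inner region -/

theorem binConv_mem {x y : ℝ} (hx : x ∈ Set.Icc (0 : ℝ) (1 / 2)) (hy : y ∈ Set.Icc (0 : ℝ) (1 / 2)) :
    binConv x y ∈ Set.Icc (0 : ℝ) (1 / 2) := by
  obtain ⟨hx0, hx1⟩ := hx
  obtain ⟨hy0, hy1⟩ := hy
  rw [binConv]
  constructor <;> nlinarith

end ShannonCipher

end

theorem mainTheorem10 (p₀ p₁ p₂ : ℝ)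
    (hp₀ : p₀ ∈ Set.Icc (0 : ℝ) (1 / 2)) (hp₁ : p₁ ∈ Set.Icc (0 : ℝ) (1 / 2))
    (hp₂ : p₂ ∈ Set.Icc (0 : ℝ) (1 / 2))
    (noise : PMF (Bool × Bool × Bool))
    (hV₁ : ShannonCipher.IsBern (noise.map fun v => v.1) p₁)
    (hV₂ : ShannonCipher.IsBern (noise.map fun v => v.2.1) p₂)
    (hV₀ : ShannonCipher.IsBern (noise.map fun v => v.2.2) p₀) :
    ShannonCipher.binaryInnerRegion p₀ p₁ p₂ ⊆
      ShannonCipher.admissibleRegion (ShannonCipher.binarySystem noise) := by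
  open ShannonCipher in
  intro τ hτ
  simp only [binaryInnerRegion, Set.mem_iUnion, Set.mem_ofPred_eq, exists_prop] at hτ
  obtain ⟨p', hp', hD₁, hD₂, hRL, hD₀, hhalf⟩ := hτ
  obtain ⟨P, hP⟩ := exists_isBern hp'.1 (by linarith [hp'.2])
  have hsub : Set.Icc (0 : ℝ) (1 / 2) ⊆ Set.Icc 0 1 := Set.Icc_subset_Icc le_rfl (by norm_num)
  have hbern : ∀ {p : ℝ} {f : Bool × Bool × Bool → Bool}, p ∈ Set.Icc (0 : ℝ) (1 / 2) →
      (∀ u v, f (xor u v.1, xor u v.2.1, xor u v.2.2) = xor u (f v)) →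
      IsBern (noise.map f) p → IsBern ((totalNoise P noise).map f) (binConv p' p) := by
    intro p f hp hf h
    rw [totalNoise_map P noise f hf]
    exact isBern_bind_xor hp'.1 (hsub hp').2 hp.1 (hsub hp).2 hP h
  have h₁ := hbern hp₁ (fun _ _ => rfl) hV₁
  have h₂ := hbern hp₂ (fun _ _ => rfl) hV₂
  have h₀ := hbern hp₀ (fun _ _ => rfl) hV₀
  have hdist : ∀ (c : ∀ n, Fin (keyCount τ.RK n) → Fin n → Bool) (ε : ℝ), 0 < ε →
      DistortionConstraint (binarySystem noise) τ.RK (fun n => maskCode P (c n)) τ.D₁ τ.D₂ ε :=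
    fun c ε hε => distortionConstraint_maskCode c (hsub (binConv_mem hp' hp₁))
      (hsub (binConv_mem hp' hp₂)) h₁ h₂ hD₁ hD₂ hε
  -- The nonpositive case absorbs `D₀ > 1/2`; secrecy is vacuous there, so the zero codebook
  -- suffices.
  by_cases hpos : τ.RL ≤ 0
  · exact ⟨fun n => maskCode P fun _ _ => false, fun ε hε =>
      ⟨hdist _ ε hε, secrecyConstraint_of_nonpos _ hpos _ hε⟩⟩
  · have hD : τ.D₀ ≤ 1 / 2 := not_lt.mp fun h => hpos (hhalf h)
    have hq := binConv_mem hp' hp₀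
    -- A positive list rate rules out the value 0 in the outer positive part.
    have hRL' : τ.RL ≤ min ((τ.RK : ℝ) + max 0 (H₂ (binConv p' p₀) - H₂ τ.D₀)) (1 - H₂ τ.D₀) := by
      refine le_min (hRL.trans (min_le_left _ _)) ?_
      rcases le_max_iff.mp (hRL.trans (min_le_right _ _)) with h | h
      · exact absurd h hpos
      · exact h
    choose c hc using fun n => exists_codebook_ballMass hq.1 hq.2 hD₀.1 hD (typSlack_nonneg n) n
      (keyCount τ.RK n)
    exact ⟨fun n => maskCode P (c n), fun ε hε =>
      ⟨hdist c ε hε, secrecyConstraint_maskCode hq.1 hq.2 h₀ hRL' c hc hε⟩⟩
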